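/- Let $\mathcal H_a,\mathcal H_b$ be finite-dimensional complex Hilbert spaces, and for density matrices $\rho,\sigma$ on the same space let $d_B(\rho,\sigma)=\sqrt{2-2F(\rho,\sigma)}$ be the Bures distance, where $F(\rho,\sigma)=\operatorname{tr}\sqrt{\sqrt{\sigma}\,\rho\,\sqrt{\sigma}}$. A state on $\mathcal H_a\otimes\mathcal H_b$ is separable if it has the form $\sum_i p_i\,\rho_a^i\otimes\rho_b^i$ (a finite sum) with $p_i\ge 0$, $\sum_i p_i=1$ and local density matrices $\rho_a^i,\rho_b^i$; a state of a bipartite system is classical-classical if it has the form $\sum_{i,j}p_{ij}\,|u_i\rangle\langle u_i|\otimes|v_j\rangle\langle v_j|$ with $p_{ij}\ge 0$, $\sum_{i,j}p_{ij}=1$ and orthonormal families $\{|u_i\rangle\}$, $\{|v_j\rangle\}$ in the two local spaces. For a density matrix $\rho_{ab}$ on $\mathcal H_a\otimes\mathcal H_b$ define $$E_B(\rho_{ab})=\min_{\sigma_{ab}\text{ separable}}d_B^2(\rho_{ab},\sigma_{ab}),\qquad \tilde{\mathcal E}_B(\rho_{ab})=\min_{\sigma}\ \min_{\operatorname{tr}_{a'b'}\rho_{aa'bb'}=\rho_{ab}}d_B^2(\rho_{aa'bb'},\sigma),$$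 where the second minimum is over all finite-dimensional ancillary spaces $\mathcal H_{a'},\mathcal H_{b'}$, all density matrices $\rho_{aa'bb'}$ on $\mathcal H_a\otimes\mathcal H_{a'}\otimes\mathcal H_b\otimes\mathcal H_{b'}$ with $\operatorname{tr}_{a'b'}\rho_{aa'bb'}=\rho_{ab}$, and all states $\sigma$ on the same space that are classical-classical with respect to the bipartition $aa':bb'$. Then for every density matrix $\rho_{ab}$ on $\mathcal H_a\otimes\mathcal H_b$ both minima are attained, and $$\tilde{\mathcal E}_B(\rho_{ab})=E_B(\rho_{ab}).$$ -/

import Mathlib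

open scoped MatrixOrder ComplexOrder Kronecker

noncomputable section

namespace BuresDiscord

/-- `ρ` is a density matrix on the Hilbert space `ℂ^n`: positive semidefinite with trace one. -/
def IsState {n : Type*} [Fintype n] (ρ : Matrix n n ℂ) : Prop :=
  ρ.PosSemidef ∧ ρ.trace = 1

/-- The rank-one matrix `|u⟩⟨u|` of a vector `u`. -/
def ketbra {n : Type*} (u : EuclideanSpace ℂ n) : Matrix n n ℂ :=
  Matrix.vecMulVec (fun i => u i) (fun j => star (u j))

/-- The (root) fidelity `F(ρ, σ) = tr √(√σ ρ √σ)`. -/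
def fidelity {n : Type*} [Fintype n] [DecidableEq n] (ρ σ : Matrix n n ℂ) : ℝ :=
  (Matrix.trace (CFC.sqrt (CFC.sqrt σ * ρ * CFC.sqrt σ))).re

/-- The Bures distance `d_B(ρ, σ) = √(2 - 2 F(ρ, σ))`. -/
def buresDist {n : Type*} [Fintype n] [DecidableEq n] (ρ σ : Matrix n n ℂ) : ℝ :=
  Real.sqrt (2 - 2 * fidelity ρ σ)

/-- `σ` is a separable state of the bipartite system `ℂ^A ⊗ ℂ^B`: a finite convex combination
`∑ i, p i • (α i ⊗ β i)` of products of local states. -/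
def IsSeparable {A B : Type*} [Fintype A] [Fintype B] (σ : Matrix (A × B) (A × B) ℂ) : Prop :=
  ∃ (k : ℕ) (p : Fin k → ℝ) (α : Fin k → Matrix A A ℂ) (β : Fin k → Matrix B B ℂ),
    (∀ i, 0 ≤ p i) ∧ ∑ i, p i = 1 ∧ (∀ i, IsState (α i)) ∧ (∀ i, IsState (β i)) ∧
    σ = ∑ i, (p i : ℂ) • (α i ⊗ₖ β i)

/-- `σ` is a classical-classical state of the bipartite system `ℂ^A ⊗ ℂ^B`:
`∑ i j, p i j • (|u i⟩⟨u i| ⊗ |v j⟩⟨v j|)` with a probability distribution `p` and orthonormal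
families `u` and `v`. -/
def IsClassicalClassical {A B : Type*} [Fintype A] [Fintype B]
    (σ : Matrix (A × B) (A × B) ℂ) : Prop :=
  ∃ (k l : ℕ) (p : Fin k → Fin l → ℝ)
    (u : Fin k → EuclideanSpace ℂ A) (v : Fin l → EuclideanSpace ℂ B),
    (∀ i j, 0 ≤ p i j) ∧ ∑ i, ∑ j, p i j = 1 ∧ Orthonormal ℂ u ∧ Orthonormal ℂ v ∧
    σ = ∑ i, ∑ j, (p i j : ℂ) • (ketbra (u i) ⊗ₖ ketbra (v j))

/-- The partial trace over the ancillas `A'` and `B'` of a matrix on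
`(ℂ^A ⊗ ℂ^A') ⊗ (ℂ^B ⊗ ℂ^B')`. -/
def traceAncillas {A A' B B' : Type*} [Fintype A'] [Fintype B']
    (τ : Matrix ((A × A') × (B × B')) ((A × A') × (B × B')) ℂ) : Matrix (A × B) (A × B) ℂ :=
  Matrix.of fun x y => ∑ a' : A', ∑ b' : B', τ ((x.1, a'), (x.2, b')) ((y.1, a'), (y.2, b'))

/-- `τ` is a two-sided state extension of `ρ`. -/
def IsExtension {A A' B B' : Type*} [Fintype A] [Fintype A'] [Fintype B] [Fintype B']
    (τ : Matrix ((A × A') × (B × B')) ((A × A') × (B × B')) ℂ)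
    (ρ : Matrix (A × B) (A × B) ℂ) : Prop :=
  IsState τ ∧ traceAncillas τ = ρ

section

variable {A B : Type*} [Fintype A] [DecidableEq A] [Fintype B] [DecidableEq B]

/-- The squared Bures distances from `ρ` to the separable states. -/
def sepDistances (ρ : Matrix (A × B) (A × B) ℂ) : Set ℝ :=
  {x | ∃ σ : Matrix (A × B) (A × B) ℂ, IsSeparable σ ∧ x = buresDist ρ σ ^ 2}

/-- The squared Bures distances from two-sided extensions of `ρ` (with ancillas `ℂ^m` and `ℂ^n` of
arbitrary finite dimensions) to states that are classical-classical for the cut `aa' : bb'`. -/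
def extDistances (ρ : Matrix (A × B) (A × B) ℂ) : Set ℝ :=
  {x | ∃ (m n : ℕ)
      (τ σ : Matrix ((A × Fin m) × (B × Fin n)) ((A × Fin m) × (B × Fin n)) ℂ),
      IsExtension τ ρ ∧ IsClassicalClassical σ ∧ x = buresDist τ σ ^ 2}

/-- The Bures distance of entanglement `E_B(ρ)`. -/
def buresEntanglement (ρ : Matrix (A × B) (A × B) ℂ) : ℝ :=
  sInf (sepDistances ρ)

/-- The minimal Bures distance of symmetric discord over state extensions. -/
def minSymmetricBuresDiscord (ρ : Matrix (A × B) (A × B) ℂ) : ℝ :=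
  sInf (extDistances ρ)

end

end BuresDiscord

end

noncomputable section

namespace BuresDiscord

open Matrix

/-! ### Factorization and trace bounds for positive semidefinite matrices -/

section MatrixLemmas

variable {m n k : Type*} [Fintype m] [Fintype n] [Fintype k]

/-! Fidelity is a semidefinite maximum: `fidelity R S` is the largest `Re tr Z` over those `Z` for
which the block matrix `[R, Z; Zᴴ, S]` is positive semidefinite (`trace_re_le_fidelity`,
`exists_trace_re_eq_fidelity`). Partial trace preserves such blocks and `tr Z`, so fidelity can only
grow. It also sends classical-classical states to separable ones, so no extension beats the closest
separable state, which exists by compactness. Conversely, write the closest separable `σ` as `Y *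
Yᴴ`, with columns `√qᵢ aᵢ ⊗ bᵢ`. Douglas factorization of an optimal `Z`, followed by completion
with extra columns, gives `X` with `X * Xᴴ = ρ` and `X * Yᴴ = Z`. Tagging column `i` with `|i⟩|i⟩`
in the ancillas makes the local vectors orthonormal, so `Y` yields a classical-classical state and
`X` an extension of `ρ`, with fidelity at least `Re tr Z` (`exists_extension_classicalClassical`).
-/

theorem _root_.Matrix.PosSemidef.exists_unitary_diagonal [DecidableEq n] {S : Matrix n n ℂ}
    (hS : S.PosSemidef) :
    ∃ (U : Matrix n n ℂ) (d : n → ℝ), Uᴴ * U = 1 ∧ U * Uᴴ = 1 ∧ (∀ i, 0 ≤ d i) ∧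
      S = U * diagonal (fun i => (d i : ℂ)) * Uᴴ := by
  refine ⟨hS.1.eigenvectorUnitary, hS.1.eigenvalues, ?_, ?_, hS.eigenvalues_nonneg, ?_⟩
  · exact Unitary.coe_star_mul_self hS.1.eigenvectorUnitary
  · exact Unitary.coe_mul_star_self hS.1.eigenvectorUnitary
  · conv_lhs => rw [hS.1.spectral_theorem]
    rfl

theorem _root_.Matrix.PosSemidef.exists_conjTranspose_mul_self [DecidableEq n] {S : Matrix n n ℂ}
    (hS : S.PosSemidef) : ∃ N : Matrix n n ℂ, S = Nᴴ * N := by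
  have h0 : (0 : Matrix n n ℂ) ≤ S := nonneg_iff_posSemidef.2 hS
  refine ⟨CFC.sqrt S, ?_⟩
  have h : (CFC.sqrt S)ᴴ = CFC.sqrt S := (nonneg_iff_posSemidef.1 (CFC.sqrt_nonneg S)).1
  rw [h, CFC.sqrt_mul_sqrt_self S h0]

/-- Existence of a Moore-Penrose inverse of a positive semidefinite matrix. -/
theorem _root_.Matrix.PosSemidef.exists_pseudoinverse [DecidableEq n] {S : Matrix n n ℂ}
    (hS : S.PosSemidef) :
    ∃ P : Matrix n n ℂ, Pᴴ = P ∧ S * P * S = S ∧ P * S * P = P := by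
  obtain ⟨U, d, hU, -, -, rfl⟩ := hS.exists_unitary_diagonal
  have key (x y z : n → ℂ) : U * diagonal x * Uᴴ * (U * diagonal y * Uᴴ) * (U * diagonal z * Uᴴ)
      = U * diagonal (fun i => x i * y i * z i) * Uᴴ := by
    calc _ = U * diagonal x * (Uᴴ * U) * diagonal y * (Uᴴ * U) * diagonal z * Uᴴ := by
          simp only [Matrix.mul_assoc]
      _ = U * (diagonal x * diagonal y * diagonal z) * Uᴴ := by
          rw [hU, Matrix.mul_one, Matrix.mul_one]; simp only [Matrix.mul_assoc]
      _ = _ := by rw [diagonal_mul_diagonal, diagonal_mul_diagonal]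
  refine ⟨U * diagonal (fun i => ((d i)⁻¹ : ℂ)) * Uᴴ, ?_, ?_, ?_⟩
  · simp only [conjTranspose_mul, conjTranspose_conjTranspose, diagonal_conjTranspose,
      Matrix.mul_assoc]
    congr 3
    ext i
    simp
  · rw [key]; simp
  · rw [key]
    congr 3
    ext i
    by_cases h : (d i : ℂ) = 0 <;> simp [h]

/-- Douglas factorization of the off-diagonal block of a positive semidefinite block matrix. -/
theorem exists_factor_of_posSemidef_fromBlocks [DecidableEq m] [DecidableEq n]
    {R : Matrix m m ℂ} {Z : Matrix m n ℂ} {Y : Matrix n k ℂ}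
    (h : (fromBlocks R Z Zᴴ (Y * Yᴴ)).PosSemidef) :
    ∃ K : Matrix m k ℂ, Z = K * Yᴴ ∧ (R - K * Kᴴ).PosSemidef := by
  obtain ⟨P, hP, hSPS, hPSP⟩ :=
    (posSemidef_self_mul_conjTranspose Y).exists_pseudoinverse
  set S := Y * Yᴴ with hS
  -- `Z` vanishes on the kernel of `S`: in a Gram factorization, `N₂ * (1 - P * S)` has zero Gram
  -- matrix.
  have hZ : Z * P * S = Z := by
    obtain ⟨N, hN⟩ := h.exists_conjTranspose_mul_self
    set N₁ := N.submatrix id Sum.inl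
    set N₂ := N.submatrix id Sum.inr
    have hZN : Z = N₁ᴴ * N₂ := by
      ext i j
      exact congrFun (congrFun hN (Sum.inl i)) (Sum.inr j)
    have hSN : S = N₂ᴴ * N₂ := by
      ext i j
      exact congrFun (congrFun hN (Sum.inr i)) (Sum.inr j)
    have h0 : N₂ * (1 - P * S) = 0 := by
      rw [← conjTranspose_mul_self_eq_zero]
      rw [conjTranspose_mul, Matrix.mul_assoc, ← Matrix.mul_assoc N₂ᴴ, ← hSN, Matrix.mul_sub,
        ← Matrix.mul_assoc S, hSPS]
      simp
    have h1 : Z * (1 - P * S) = 0 := by rw [hZN, Matrix.mul_assoc, h0, Matrix.mul_zero]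
    rw [Matrix.mul_sub, Matrix.mul_one, sub_eq_zero, ← Matrix.mul_assoc] at h1
    exact h1.symm
  refine ⟨Z * P * Y, by rw [Matrix.mul_assoc, ← hS, hZ], ?_⟩
  -- This compression of the block matrix is the generalized Schur complement `R - Z * P * Zᴴ`.
  have h1 := h.mul_mul_conjTranspose_same (fromCols (1 : Matrix m m ℂ) (-(Z * P)))
  have hK : Z * P * Y * (Z * P * Y)ᴴ = Z * P * Zᴴ := by
    calc _ = Z * (P * (Y * Yᴴ) * Pᴴ) * Zᴴ := by
          simp only [conjTranspose_mul, Matrix.mul_assoc]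
      _ = _ := by rw [hP, ← hS, hPSP]
  rw [hK]
  convert h1 using 1
  rw [fromCols_mul_fromBlocks, conjTranspose_fromCols_eq_fromRows_conjTranspose,
    fromCols_mul_fromRows]
  simp [hZ, Matrix.mul_assoc, sub_eq_add_neg]

/-- In an eigenbasis of `S` the bound holds entry by entry on the diagonal: `(Re Aᵢᵢ)² ≤ (A Aᴴ)ᵢᵢ ≤
dᵢ²`. -/
theorem trace_re_le_of_posSemidef_sub [DecidableEq n] {S A : Matrix n n ℂ} (hS : S.PosSemidef)
    (h : (S * S - A * Aᴴ).PosSemidef) : A.trace.re ≤ S.trace.re := by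
  obtain ⟨U, d, hU, hU', hd, rfl⟩ := hS.exists_unitary_diagonal
  set D := diagonal (fun i => (d i : ℂ)) with hD
  set A' := Uᴴ * A * U with hA'
  have htr (X : Matrix n n ℂ) : (Uᴴ * X * U).trace = X.trace := by
    rw [Matrix.mul_assoc, trace_mul_comm, Matrix.mul_assoc, hU', Matrix.mul_one]
  have hUD : Uᴴ * (U * D * Uᴴ) * U = D := by
    calc _ = (Uᴴ * U) * D * (Uᴴ * U) := by simp only [Matrix.mul_assoc]
      _ = D := by rw [hU, Matrix.one_mul, Matrix.mul_one]
  rw [← htr A, ← htr (U * D * Uᴴ), hUD]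
  have h1 : (D * D - A' * A'ᴴ).PosSemidef := by
    convert h.conjTranspose_mul_mul_same U using 1
    rw [Matrix.mul_sub, Matrix.sub_mul]
    congr 1
    · calc D * D = Uᴴ * (U * D * Uᴴ) * U * (Uᴴ * (U * D * Uᴴ) * U) := by rw [hUD]
        _ = Uᴴ * (U * D * Uᴴ) * (U * Uᴴ) * ((U * D * Uᴴ) * U) := by
          simp only [Matrix.mul_assoc]
        _ = _ := by rw [hU']; simp only [Matrix.mul_assoc, Matrix.one_mul]
    · calc A' * A'ᴴ = Uᴴ * A * (U * Uᴴ) * (Aᴴ * U) := by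
            simp only [hA', Matrix.mul_assoc, conjTranspose_mul, conjTranspose_conjTranspose]
        _ = _ := by rw [hU']; simp only [Matrix.mul_assoc, Matrix.one_mul]
  rw [trace, trace, Complex.re_sum, Complex.re_sum]
  refine Finset.sum_le_sum fun i _ => ?_
  have h2 := (Complex.le_def.1 (h1.diag_nonneg (i := i))).1
  have h3 : (A' i i).re * (A' i i).re ≤ ((A' * A'ᴴ) i i).re := by
    rw [mul_apply, Complex.re_sum]
    refine le_trans ?_ (Finset.single_le_sum (f := fun j => (A' i j * A'ᴴ j i).re)
      (fun j _ => ?_) (Finset.mem_univ i))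
    · simp only [conjTranspose_apply, Complex.mul_re, Complex.star_def, Complex.conj_re,
        Complex.conj_im]
      nlinarith [mul_self_nonneg (A' i i).im]
    · simp only [conjTranspose_apply, Complex.mul_re, Complex.star_def, Complex.conj_re,
        Complex.conj_im]
      nlinarith [mul_self_nonneg (A' i j).im, mul_self_nonneg (A' i j).re]
  have h4 : ((D * D) i i).re = d i * d i := by simp [hD]
  have h5 : (D i i).re = d i := by simp [hD]
  simp only [diag_apply, h5]
  simp only [Matrix.sub_apply, Complex.sub_re, h4, Complex.zero_re] at h2
  exact abs_le_of_sq_le_sq' (by nlinarith) (hd i) |>.2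

end MatrixLemmas

/-! ### Fidelity as a semidefinite maximum -/

section Fidelity

variable {n : Type*} [Fintype n] [DecidableEq n]

theorem sqrt_posSemidef (S : Matrix n n ℂ) : (CFC.sqrt S).PosSemidef :=
  nonneg_iff_posSemidef.1 (CFC.sqrt_nonneg S)

theorem sqrt_conjTranspose (S : Matrix n n ℂ) : (CFC.sqrt S)ᴴ = CFC.sqrt S :=
  (sqrt_posSemidef S).1

theorem _root_.Matrix.PosSemidef.sqrt_mul_sqrt {S : Matrix n n ℂ} (hS : S.PosSemidef) :
    CFC.sqrt S * CFC.sqrt S = S :=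
  CFC.sqrt_mul_sqrt_self S (nonneg_iff_posSemidef.2 hS)

theorem sqrt_mul_mul_sqrt_posSemidef {R : Matrix n n ℂ} (S : Matrix n n ℂ) (hR : R.PosSemidef) :
    (CFC.sqrt S * R * CFC.sqrt S).PosSemidef := by
  have := hR.mul_mul_conjTranspose_same (CFC.sqrt S)
  rwa [sqrt_conjTranspose] at this

/-- With `Z = K √S` and `K Kᴴ ≤ R`, the matrix `A = √S K` satisfies `A Aᴴ ≤ √S R √S`, the square of
the matrix whose trace is the fidelity. -/
theorem trace_re_le_fidelity {R S Z : Matrix n n ℂ}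
    (h : (fromBlocks R Z Zᴴ S).PosSemidef) : Z.trace.re ≤ fidelity R S := by
  have hR : R.PosSemidef := h.submatrix Sum.inl
  have hS : S.PosSemidef := h.submatrix Sum.inr
  have h' : (fromBlocks R Z Zᴴ (CFC.sqrt S * (CFC.sqrt S)ᴴ)).PosSemidef := by
    rwa [sqrt_conjTranspose, hS.sqrt_mul_sqrt]
  obtain ⟨K, rfl, hK⟩ := exists_factor_of_posSemidef_fromBlocks h'
  rw [trace_mul_comm]
  refine trace_re_le_of_posSemidef_sub (sqrt_posSemidef _) ?_
  rw [(sqrt_mul_mul_sqrt_posSemidef S hR).sqrt_mul_sqrt]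
  convert hK.mul_mul_conjTranspose_same (CFC.sqrt S) using 1
  simp only [Matrix.mul_sub, Matrix.sub_mul, sqrt_conjTranspose, conjTranspose_mul,
    Matrix.mul_assoc]

theorem exists_trace_re_eq_fidelity {R S : Matrix n n ℂ} (hR : R.PosSemidef)
    (hS : S.PosSemidef) :
    ∃ Z : Matrix n n ℂ, (fromBlocks R Z Zᴴ S).PosSemidef ∧ Z.trace.re = fidelity R S := by
  set r := CFC.sqrt R with hr
  set s := CFC.sqrt S with hs
  set T := CFC.sqrt (s * R * s) with hT
  have hrH : rᴴ = r := sqrt_conjTranspose R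
  have hsH : sᴴ = s := sqrt_conjTranspose S
  have hTH : Tᴴ = T := sqrt_conjTranspose _
  have hss : s * s = S := hS.sqrt_mul_sqrt
  have hrr : r * r = R := hR.sqrt_mul_sqrt
  have hTT : T * T = (s * r) * (s * r)ᴴ := by
    rw [hT, (sqrt_mul_mul_sqrt_posSemidef S hR).sqrt_mul_sqrt, conjTranspose_mul, hrH,
      hsH, ← hrr]
    simp only [hs, Matrix.mul_assoc]
  have h1 : (fromBlocks 1 T Tᴴ ((s * r) * (s * r)ᴴ)).PosSemidef := by
    convert posSemidef_self_mul_conjTranspose (fromRows (1 : Matrix n n ℂ) T) using 1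
    rw [conjTranspose_fromRows_eq_fromCols_conjTranspose, fromRows_mul_fromCols, ← hTT, hTH]
    simp
  -- A polar decomposition without invertibility: `T = K (s r)ᴴ` with `K` a contraction, so `r Kᴴ s`
  -- has the trace of `T`.
  obtain ⟨K, hK, hK1⟩ := exists_factor_of_posSemidef_fromBlocks h1
  have h2 : (fromBlocks 1 Kᴴ Kᴴᴴ 1).PosSemidef := by
    have : Invertible (1 : Matrix n n ℂ) := invertibleOne
    rw [PosDef.fromBlocks₁₁ _ _ PosDef.one]
    simpa using hK1
  refine ⟨r * Kᴴ * s, ?_, ?_⟩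
  · convert h2.mul_mul_conjTranspose_same (fromBlocks r 0 0 s) using 1
    simp [fromBlocks_multiply, fromBlocks_conjTranspose, hrH, hsH, hrr, hss, Matrix.mul_assoc]
  · have : T = s * r * Kᴴ := by
      rw [← hTH, hK]; simp
    rw [fidelity, ← hs, ← hT, this, Matrix.mul_assoc s, trace_mul_comm s]

end Fidelity

/-! ### Compactness of convex hulls -/

section ConvexHull

variable {E : Type*} [AddCommGroup E] [Module ℝ E] [FiniteDimensional ℝ E]

/-- Carathéodory: at most `finrank + 1` points are needed, which makes the hull a finite union of
continuous images. -/
theorem convexHull_eq_biUnion_image_stdSimplex (s : Set E) :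
    convexHull ℝ s = ⋃ k ∈ Finset.range (Module.finrank ℝ E + 2),
      (fun x : (Fin k → ℝ) × (Fin k → E) => ∑ i, x.1 i • x.2 i) ''
        (stdSimplex ℝ (Fin k) ×ˢ Set.univ.pi fun _ => s) := by
  ext x
  simp only [Set.mem_iUnion, Set.mem_image, Set.mem_prod, Prod.exists, exists_prop,
    Finset.mem_range]
  constructor
  · intro hx
    obtain ⟨ι, _, z, w, hz, haff, hw, hw1, rfl⟩ := eq_pos_convex_span_of_mem_convexHull hx
    let e := Fintype.equivFin ι
    refine ⟨Fintype.card ι, ?_, w ∘ e.symm, z ∘ e.symm, ⟨⟨fun i => (hw _).le, ?_⟩, ?_⟩, ?_⟩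
    · have h1 := haff.card_le_finrank_succ
      have h2 := Submodule.finrank_le (vectorSpan ℝ (Set.range z))
      omega
    · rw [← hw1]
      exact Equiv.sum_comp e.symm w
    · exact fun i _ => hz ⟨_, rfl⟩
    · exact Equiv.sum_comp e.symm fun i => w i • z i
  · rintro ⟨k, -, w, z, ⟨⟨hw, hw1⟩, hz⟩, rfl⟩
    exact mem_convexHull_of_exists_fintype w z hw hw1 (fun i => hz i trivial) rfl

theorem isCompact_convexHull [TopologicalSpace E] [ContinuousAdd E] [ContinuousSMul ℝ E]
    {s : Set E} (hs : IsCompact s) : IsCompact (convexHull ℝ s) := by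
  rw [convexHull_eq_biUnion_image_stdSimplex]
  refine Finset.isCompact_biUnion _ fun k _ => ?_
  refine ((isCompact_stdSimplex ℝ _).prod (isCompact_univ_pi fun _ => hs)).image ?_
  fun_prop

end ConvexHull

/-! ### Compactness of the set of separable states -/

section Separable

variable {A B : Type*} [Fintype A] [Fintype B]

/-- The projections onto unit product vectors. -/
def pureProducts (A B : Type*) [Fintype A] [Fintype B] : Set (Matrix (A × B) (A × B) ℂ) :=
  {σ | ∃ (a : EuclideanSpace ℂ A) (b : EuclideanSpace ℂ B), ‖a‖ = 1 ∧ ‖b‖ = 1 ∧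
    σ = ketbra a ⊗ₖ ketbra b}

theorem ketbra_trace (u : EuclideanSpace ℂ A) : (ketbra u).trace = (‖u‖ ^ 2 : ℝ) := by
  rw [EuclideanSpace.norm_sq_eq]
  simp [ketbra, trace, vecMulVec_apply, Complex.mul_conj, Complex.normSq_eq_norm_sq]

theorem ketbra_isState {u : EuclideanSpace ℂ A} (hu : ‖u‖ = 1) : IsState (ketbra u) :=
  ⟨posSemidef_vecMulVec_self_star _, by simp [ketbra_trace, hu]⟩

omit [Fintype A] in
theorem continuous_ketbra : Continuous (ketbra : EuclideanSpace ℂ A → Matrix A A ℂ) := by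
  refine continuous_matrix fun i j => ?_
  simp only [ketbra, vecMulVec_apply]
  fun_prop

theorem isCompact_pureProducts : IsCompact (pureProducts A B) := by
  have h : pureProducts A B = (fun x : EuclideanSpace ℂ A × EuclideanSpace ℂ B =>
      ketbra x.1 ⊗ₖ ketbra x.2) '' (Metric.sphere 0 1 ×ˢ Metric.sphere 0 1) := by
    ext σ
    constructor
    · rintro ⟨a, b, ha, hb, rfl⟩
      exact ⟨(a, b), by simp [ha, hb], rfl⟩
    · rintro ⟨⟨a, b⟩, hab, rfl⟩
      simp only [Set.mem_prod, mem_sphere_zero_iff_norm] at hab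
      exact ⟨a, b, hab.1, hab.2, rfl⟩
  rw [h]
  refine ((isCompact_sphere _ _).prod (isCompact_sphere _ _)).image ?_
  refine continuous_matrix fun i j => ?_
  simp only [kroneckerMap_apply]
  exact ((continuous_ketbra.comp continuous_fst).matrix_elem _ _).mul
    ((continuous_ketbra.comp continuous_snd).matrix_elem _ _)

theorem IsState.exists_pure_decomposition [DecidableEq A] {α : Matrix A A ℂ} (h : IsState α) :
    ∃ (q : A → ℝ) (e : A → EuclideanSpace ℂ A), (∀ i, 0 ≤ q i) ∧ ∑ i, q i = 1 ∧
      (∀ i, ‖e i‖ = 1) ∧ α = ∑ i, (q i : ℂ) • ketbra (e i) := by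
  obtain ⟨U, d, hU, -, hd, rfl⟩ := h.1.exists_unitary_diagonal
  have htr := h.2
  refine ⟨d, fun i => WithLp.toLp 2 fun x => U x i, hd, ?_, fun i => ?_, ?_⟩
  · rw [trace_mul_comm, ← Matrix.mul_assoc, hU, Matrix.one_mul, trace_diagonal] at htr
    exact_mod_cast htr
  · have h1 : ((‖WithLp.toLp 2 fun x => U x i‖ ^ 2 : ℝ) : ℂ) = 1 := by
      rw [← ketbra_trace]
      have := congrFun (congrFun hU i) i
      rw [mul_apply, one_apply_eq] at this
      rw [← this]
      simp [ketbra, trace, vecMulVec_apply, mul_comm]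
    have h2 : ‖WithLp.toLp 2 fun x => U x i‖ ^ 2 = 1 := by exact_mod_cast h1
    exact (pow_eq_one_iff_of_nonneg (norm_nonneg _) two_ne_zero).1 h2
  · ext x y
    rw [mul_apply]
    simp only [mul_diagonal, Matrix.sum_apply, Matrix.smul_apply, ketbra, vecMulVec_apply,
      conjTranspose_apply, smul_eq_mul]
    exact Finset.sum_congr rfl fun i _ => by ring

theorem isSeparable_of_fintype {ι : Type*} [Fintype ι] (p : ι → ℝ) (α : ι → Matrix A A ℂ)
    (β : ι → Matrix B B ℂ) (hp : ∀ i, 0 ≤ p i) (hp1 : ∑ i, p i = 1) (hα : ∀ i, IsState (α i))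
    (hβ : ∀ i, IsState (β i)) : IsSeparable (∑ i, (p i : ℂ) • (α i ⊗ₖ β i)) := by
  let e := (Fintype.equivFin ι).symm
  exact ⟨Fintype.card ι, p ∘ e, α ∘ e, β ∘ e, fun _ => hp _, (Equiv.sum_comp e p).trans hp1,
    fun _ => hα _, fun _ => hβ _,
    (Equiv.sum_comp e fun i => (p i : ℂ) • (α i ⊗ₖ β i)).symm⟩

/-- Spectral decomposition of the local states reduces every mixture to pure products, which form a
compact set. -/
theorem isSeparable_iff_mem_convexHull [DecidableEq A] [DecidableEq B]
    {σ : Matrix (A × B) (A × B) ℂ} :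
    IsSeparable σ ↔ σ ∈ convexHull ℝ (pureProducts A B) := by
  constructor
  · rintro ⟨k, p, α, β, hp, hp1, hα, hβ, rfl⟩
    have h : ∑ i, (p i : ℂ) • (α i ⊗ₖ β i) = ∑ i, p i • (α i ⊗ₖ β i) := by
      ext x y
      simp [Matrix.sum_apply]
    rw [h]
    refine (convex_convexHull ℝ _).sum_mem (fun i _ => hp i) hp1 fun i _ => ?_
    obtain ⟨q, a, hq, hq1, ha, hαi⟩ := (hα i).exists_pure_decomposition
    obtain ⟨r, b, hr, hr1, hb, hβi⟩ := (hβ i).exists_pure_decomposition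
    refine mem_convexHull_of_exists_fintype (fun x : A × B => q x.1 * r x.2)
      (fun x => ketbra (a x.1) ⊗ₖ ketbra (b x.2)) (fun x => mul_nonneg (hq _) (hr _)) ?_
      (fun x => ⟨_, _, ha _, hb _, rfl⟩) ?_
    · rw [Fintype.sum_prod_type, ← Finset.sum_mul_sum, hq1, hr1, one_mul]
    · ext x y
      simp only [hαi, hβi, kroneckerMap_apply, Matrix.sum_apply, Finset.sum_mul_sum,
        Fintype.sum_prod_type, Matrix.smul_apply, Complex.real_smul, smul_eq_mul, Complex.ofReal_mul]
      exact Finset.sum_congr rfl fun i _ => Finset.sum_congr rfl fun j _ => by ring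
  · intro h
    rw [mem_convexHull_iff_exists_fintype] at h
    obtain ⟨ι, _, w, z, hw, hw1, hz, rfl⟩ := h
    choose a b ha hb hab using hz
    have := isSeparable_of_fintype w _ _ hw hw1 (fun i => ketbra_isState (ha i))
      (fun i => ketbra_isState (hb i))
    convert this using 1
    ext x y
    simp [Matrix.sum_apply, hab]

theorem isCompact_setOf_isSeparable [DecidableEq A] [DecidableEq B] :
    IsCompact {σ : Matrix (A × B) (A × B) ℂ | IsSeparable σ} := by
  simp only [isSeparable_iff_mem_convexHull]
  exact isCompact_convexHull isCompact_pureProducts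

theorem IsSeparable.isState {σ : Matrix (A × B) (A × B) ℂ} (h : IsSeparable σ) : IsState σ := by
  classical
  obtain ⟨k, p, α, β, hp, hp1, hα, hβ, rfl⟩ := h
  refine ⟨posSemidef_sum _ fun i _ => ?_, ?_⟩
  · exact ((hα i).1.kronecker (hβ i).1).smul (by exact_mod_cast hp i)
  · simp only [trace_sum, trace_smul, trace_kronecker, (hα _).2, (hβ _).2]
    simpa using congrArg (Complex.ofReal) hp1

end Separable

/-! ### Partial trace and monotonicity of fidelity -/

section PartialTrace

variable {A A' B B' : Type*} [Fintype A] [Fintype A'] [Fintype B] [Fintype B']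

omit [Fintype A] [Fintype B] in
theorem traceAncillas_eq_sum
    (τ : Matrix ((A × A') × (B × B')) ((A × A') × (B × B')) ℂ) :
    traceAncillas τ = ∑ c : A' × B', τ.submatrix (fun x : A × B => ((x.1, c.1), (x.2, c.2)))
      (fun x : A × B => ((x.1, c.1), (x.2, c.2))) := by
  ext x y
  simp [traceAncillas, Matrix.sum_apply, Fintype.sum_prod_type]

theorem trace_traceAncillas (τ : Matrix ((A × A') × (B × B')) ((A × A') × (B × B')) ℂ) :
    (traceAncillas τ).trace = τ.trace := by
  simp only [trace, diag_apply, traceAncillas, of_apply, Fintype.sum_prod_type]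
  refine Finset.sum_congr rfl fun a _ => ?_
  exact Finset.sum_comm

omit [Fintype A] [Fintype B] in
-- Partial trace is a sum of principal submatrices, taken simultaneously in all four blocks.
theorem posSemidef_fromBlocks_traceAncillas
    {R Z S : Matrix ((A × A') × (B × B')) ((A × A') × (B × B')) ℂ}
    (h : (fromBlocks R Z Zᴴ S).PosSemidef) :
    (fromBlocks (traceAncillas R) (traceAncillas Z) (traceAncillas Z)ᴴ
      (traceAncillas S)).PosSemidef := by
  let e (c : A' × B') (x : A × B) : (A × A') × (B × B') := ((x.1, c.1), (x.2, c.2))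
  have h1 : fromBlocks (traceAncillas R) (traceAncillas Z) (traceAncillas Z)ᴴ (traceAncillas S)
      = ∑ c : A' × B', (fromBlocks R Z Zᴴ S).submatrix (Sum.map (e c) (e c))
        (Sum.map (e c) (e c)) := by
    ext (i | i) (j | j) <;> simp [traceAncillas_eq_sum, Matrix.sum_apply, e]
  rw [h1]
  exact posSemidef_sum _ fun c _ => h.submatrix _

theorem fidelity_le_fidelity_traceAncillas [DecidableEq A] [DecidableEq A'] [DecidableEq B]
    [DecidableEq B'] {R S : Matrix ((A × A') × (B × B')) ((A × A') × (B × B')) ℂ}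
    (hR : R.PosSemidef) (hS : S.PosSemidef) :
    fidelity R S ≤ fidelity (traceAncillas R) (traceAncillas S) := by
  obtain ⟨Z, hZ, hZF⟩ := exists_trace_re_eq_fidelity hR hS
  rw [← hZF, ← trace_traceAncillas Z]
  exact trace_re_le_fidelity (posSemidef_fromBlocks_traceAncillas hZ)

/-- The reduced state on `ℂ^A` of a vector of `ℂ^A ⊗ ℂ^A'`. -/
def reducedState (u : EuclideanSpace ℂ (A × A')) : Matrix A A ℂ :=
  Matrix.of fun x y => ∑ a', u (x, a') * star (u (y, a'))

omit [Fintype A] [Fintype B] in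
theorem traceAncillas_kronecker_ketbra (u : EuclideanSpace ℂ (A × A'))
    (v : EuclideanSpace ℂ (B × B')) :
    traceAncillas (ketbra u ⊗ₖ ketbra v) = reducedState u ⊗ₖ reducedState v := by
  ext x y
  simp [traceAncillas, reducedState, ketbra, vecMulVec_apply, Finset.sum_mul_sum]

omit [Fintype A] [Fintype B] in
theorem traceAncillas_smul (c : ℂ) (τ : Matrix ((A × A') × (B × B')) ((A × A') × (B × B')) ℂ) :
    traceAncillas (c • τ) = c • traceAncillas τ := by
  ext x y
  simp [traceAncillas, Finset.mul_sum]

omit [Fintype A] [Fintype B] in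
theorem traceAncillas_sum {ι : Type*} (s : Finset ι)
    (τ : ι → Matrix ((A × A') × (B × B')) ((A × A') × (B × B')) ℂ) :
    traceAncillas (∑ i ∈ s, τ i) = ∑ i ∈ s, traceAncillas (τ i) := by
  ext x y
  simp only [traceAncillas_eq_sum, Matrix.sum_apply, submatrix_apply]
  exact Finset.sum_comm

theorem reducedState_isState {u : EuclideanSpace ℂ (A × A')} (hu : ‖u‖ = 1) :
    IsState (reducedState u) := by
  constructor
  · convert posSemidef_self_mul_conjTranspose (Matrix.of fun (x : A) (a' : A') => u (x, a'))
      using 1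
    ext x y
    simp [reducedState, mul_apply]
  · have h := (ketbra_isState hu).2
    rw [← h]
    simp [trace, reducedState, ketbra, vecMulVec_apply, Fintype.sum_prod_type]

theorem IsClassicalClassical.isState {σ : Matrix (A × B) (A × B) ℂ}
    (h : IsClassicalClassical σ) : IsState σ := by
  classical
  obtain ⟨k, l, p, u, v, hp, hp1, hu, hv, rfl⟩ := h
  have := isSeparable_of_fintype (fun c : Fin k × Fin l => p c.1 c.2) _ _ (fun c => hp _ _)
    (by rw [Fintype.sum_prod_type]; exact hp1) (fun c => ketbra_isState (hu.1 c.1))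
    (fun c => ketbra_isState (hv.1 c.2))
  rw [Fintype.sum_prod_type] at this
  exact this.isState

theorem IsClassicalClassical.isSeparable_traceAncillas
    {σ : Matrix ((A × A') × (B × B')) ((A × A') × (B × B')) ℂ}
    (h : IsClassicalClassical σ) : IsSeparable (traceAncillas σ) := by
  obtain ⟨k, l, p, u, v, hp, hp1, hu, hv, rfl⟩ := h
  have := isSeparable_of_fintype (fun c : Fin k × Fin l => p c.1 c.2) _ _ (fun c => hp _ _)
    (by rw [Fintype.sum_prod_type]; exact hp1) (fun c => reducedState_isState (hu.1 c.1))
    (fun c => reducedState_isState (hv.1 c.2))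
  simpa only [traceAncillas_sum, traceAncillas_smul, traceAncillas_kronecker_ketbra,
    Fintype.sum_prod_type] using this

end PartialTrace

/-! ### Existence of a closest state -/

section Maximizer

variable {n : Type*} [Fintype n] [DecidableEq n]

/-- Continuity of fidelity is not needed: the continuous function `Re tr` of the off-diagonal block
is maximized over the compact set of Gram factors `N` of admissible block matrices. -/
theorem exists_isMaxOn_fidelity {R : Matrix n n ℂ} (hR : IsState R)
    {C : Set (Matrix n n ℂ)} (hC : IsCompact C) (hne : C.Nonempty) (hCs : ∀ S ∈ C, IsState S) :
    ∃ S ∈ C, ∀ S' ∈ C, fidelity R S' ≤ fidelity R S := by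
  let T : Set (Matrix (n ⊕ n) (n ⊕ n) ℂ) :=
    {N | (Nᴴ * N).toBlocks₁₁ = R ∧ (Nᴴ * N).toBlocks₂₂ ∈ C}
  have hgram : Continuous fun N : Matrix (n ⊕ n) (n ⊕ n) ℂ => Nᴴ * N :=
    (continuous_id.matrix_conjTranspose).matrix_mul continuous_id
  have hsub (f g : n → n ⊕ n) :
      Continuous fun N : Matrix (n ⊕ n) (n ⊕ n) ℂ => (Nᴴ * N).submatrix f g :=
    hgram.matrix_submatrix f g
  have hT : IsClosed T :=
    (isClosed_singleton.preimage (hsub Sum.inl Sum.inl)).inter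
      (hC.isClosed.preimage (hsub Sum.inr Sum.inr))
  have hTc : IsCompact T := by
    -- Both diagonal blocks have trace one, so the squared entries of `N` sum to `2`; radius `2` is
    -- a generous bound.
    refine (isCompact_univ_pi fun _ => isCompact_univ_pi fun _ =>
      isCompact_closedBall (0 : ℂ) 2).of_isClosed_subset hT ?_
    intro (N : Matrix (n ⊕ n) (n ⊕ n) ℂ) ⟨h1, h2⟩ i _ j _
    have htr : (Nᴴ * N).trace = 2 := by
      rw [trace, Fintype.sum_sum_type]
      change (Nᴴ * N).toBlocks₁₁.trace + (Nᴴ * N).toBlocks₂₂.trace = 2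
      rw [h1, hR.2, (hCs _ h2).2]
      norm_num
    have hsum : ∑ l, ∑ k, ‖N k l‖ ^ 2 = 2 := by
      have h3 : ((∑ l, ∑ k, ‖N k l‖ ^ 2 : ℝ) : ℂ) = (Nᴴ * N).trace := by
        simp [-Fintype.sum_sum_type, trace, mul_apply, Complex.conj_mul']
      rw [htr] at h3
      exact_mod_cast h3
    have h4 : ‖N i j‖ ^ 2 ≤ 2 := by
      rw [← hsum]
      refine le_trans ?_ (Finset.single_le_sum (f := fun l => ∑ k, ‖N k l‖ ^ 2)
        (fun l _ => Finset.sum_nonneg fun k _ => sq_nonneg _) (Finset.mem_univ j))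
      exact Finset.single_le_sum (f := fun k => ‖N k j‖ ^ 2) (fun k _ => sq_nonneg _)
        (Finset.mem_univ i)
    rw [mem_closedBall_zero_iff]
    nlinarith [norm_nonneg (N i j)]
  have hlift : ∀ S ∈ C, ∃ N ∈ T, (Nᴴ * N).toBlocks₁₂.trace.re = fidelity R S := by
    intro S hS
    obtain ⟨Z, hZ, hZF⟩ := exists_trace_re_eq_fidelity hR.1 (hCs S hS).1
    obtain ⟨N, hN⟩ := hZ.exists_conjTranspose_mul_self
    refine ⟨N, ⟨?_, ?_⟩, ?_⟩
    · rw [← hN, toBlocks_fromBlocks₁₁]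
    · rwa [← hN, toBlocks_fromBlocks₂₂]
    · rw [← hN, toBlocks_fromBlocks₁₂, hZF]
  obtain ⟨S₀, hS₀⟩ := hne
  obtain ⟨N₀, hN₀, -⟩ := hlift S₀ hS₀
  obtain ⟨N, ⟨hN1, hN2⟩, hNmax⟩ := hTc.exists_isMaxOn ⟨N₀, hN₀⟩
    (f := fun N => (Nᴴ * N).toBlocks₁₂.trace.re)
    (Complex.continuous_re.comp (hsub Sum.inl Sum.inr).matrix_trace).continuousOn
  refine ⟨_, hN2, fun S' hS' => ?_⟩
  obtain ⟨N', hN', hF⟩ := hlift S' hS'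
  rw [← hF]
  refine (hNmax hN').trans (trace_re_le_fidelity ?_)
  have hps := posSemidef_conjTranspose_mul_self N
  have h21 : (Nᴴ * N).toBlocks₂₁ = (Nᴴ * N).toBlocks₁₂ᴴ := by
    ext i j
    exact (hps.1.apply (Sum.inr i) (Sum.inl j)).symm
  rwa [← fromBlocks_toBlocks (Nᴴ * N), hN1, h21] at hps

end Maximizer

/-! ### Tagged extensions -/

section Extension

variable {A B ι : Type*} [Fintype A] [Fintype B] [Fintype ι] [DecidableEq ι]

/-- The matrix with columns `x i ⊗ |i⟩ ⊗ |i⟩`, where `x i` is the `i`-th column of `X`. -/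
def tagColumns (X : Matrix (A × B) ι ℂ) : Matrix ((A × ι) × (B × ι)) ι ℂ :=
  Matrix.of fun w i => if w.1.2 = i ∧ w.2.2 = i then X (w.1.1, w.2.1) i else 0

omit [Fintype A] [Fintype B] in
-- An ancilla value `(c, d)` selects column `i` only if `c = d = i`, so distinct columns never mix
-- and the sum over tags rebuilds the product.
theorem traceAncillas_tagColumns_mul (X Y : Matrix (A × B) ι ℂ) :
    traceAncillas (tagColumns X * (tagColumns Y)ᴴ) = X * Yᴴ := by
  ext x y
  simp [traceAncillas, tagColumns, mul_apply, ite_and, apply_ite]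

/-- The vector `a ⊗ |i⟩`. -/
def tagVector (a : EuclideanSpace ℂ A) (i : ι) : EuclideanSpace ℂ (A × ι) :=
  WithLp.toLp 2 fun x => if x.2 = i then a x.1 else 0

theorem orthonormal_tagVector {a : ι → EuclideanSpace ℂ A} (ha : ∀ i, ‖a i‖ = 1) :
    Orthonormal ℂ fun i => tagVector (a i) i := by
  rw [orthonormal_iff_ite]
  intro i j
  have h : inner ℂ (a i) (a i) = 1 := by simp [inner_self_eq_norm_sq_to_K, ha]
  rw [PiLp.inner_apply] at h
  split_ifs with hij
  · subst hij
    rw [← h, PiLp.inner_apply, Fintype.sum_prod_type]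
    refine Finset.sum_congr rfl fun x _ => ?_
    rw [Finset.sum_eq_single i] <;> simp +contextual [tagVector]
  · simp [PiLp.inner_apply, tagVector, Fintype.sum_prod_type, Ne.symm hij]

/-- The matrix with columns `√(q i) • (a i ⊗ b i)`. -/
def productColumns (q : ι → ℝ) (a : ι → EuclideanSpace ℂ A) (b : ι → EuclideanSpace ℂ B) :
    Matrix (A × B) ι ℂ :=
  Matrix.of fun x i => (Real.sqrt (q i) : ℂ) * (a i x.1 * b i x.2)

omit [Fintype A] [Fintype B] [DecidableEq ι] in
theorem productColumns_mul_conjTranspose {q : ι → ℝ} (hq : ∀ i, 0 ≤ q i)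
    (a : ι → EuclideanSpace ℂ A) (b : ι → EuclideanSpace ℂ B) :
    productColumns q a b * (productColumns q a b)ᴴ =
      ∑ i, (q i : ℂ) • (ketbra (a i) ⊗ₖ ketbra (b i)) := by
  ext x y
  simp only [mul_apply, productColumns, of_apply, conjTranspose_apply, Matrix.sum_apply,
    Matrix.smul_apply, kroneckerMap_apply, ketbra, vecMulVec_apply, smul_eq_mul, star_mul']
  refine Finset.sum_congr rfl fun i _ => ?_
  have h : (q i : ℂ) = Real.sqrt (q i) * Real.sqrt (q i) := by
    rw [← Complex.ofReal_mul, Real.mul_self_sqrt (hq i)]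
  rw [h]
  simp only [Complex.star_def, Complex.conj_ofReal]
  ring

omit [Fintype A] [Fintype B] [Fintype ι] in
theorem tagColumns_productColumns (q : ι → ℝ) (a : ι → EuclideanSpace ℂ A)
    (b : ι → EuclideanSpace ℂ B) :
    tagColumns (productColumns q a b) =
      productColumns q (fun i => tagVector (a i) i) fun i => tagVector (b i) i := by
  ext w i
  simp only [tagColumns, productColumns, tagVector, of_apply]
  split_ifs <;> simp_all

theorem isClassicalClassical_tagColumns {N : ℕ} {q : Fin N → ℝ} (hq : ∀ i, 0 ≤ q i)
    (hq1 : ∑ i, q i = 1) {a : Fin N → EuclideanSpace ℂ A} {b : Fin N → EuclideanSpace ℂ B}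
    (ha : ∀ i, ‖a i‖ = 1) (hb : ∀ i, ‖b i‖ = 1) :
    IsClassicalClassical
      (tagColumns (productColumns q a b) * (tagColumns (productColumns q a b))ᴴ) := by
  refine ⟨N, N, fun i j => if i = j then q i else 0, _, _, fun i j => ?_, ?_,
    orthonormal_tagVector ha, orthonormal_tagVector hb, ?_⟩
  · dsimp only
    split_ifs
    · exact hq i
    · exact le_rfl
  · simpa using hq1
  · rw [tagColumns_productColumns, productColumns_mul_conjTranspose hq]
    simp [apply_ite, ite_smul]

theorem exists_extension_classicalClassical [DecidableEq A] [DecidableEq B]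
    {ρ σ Z : Matrix (A × B) (A × B) ℂ} (hρ : IsState ρ) (hσ : IsSeparable σ)
    (h : (fromBlocks ρ Z Zᴴ σ).PosSemidef) :
    ∃ (N : ℕ) (τ σ' : Matrix ((A × Fin N) × (B × Fin N)) ((A × Fin N) × (B × Fin N)) ℂ),
      IsExtension τ ρ ∧ IsClassicalClassical σ' ∧ Z.trace.re ≤ fidelity τ σ' := by
  obtain ⟨κ, _, w, z, hw, hw1, hz, hσz⟩ :=
    mem_convexHull_iff_exists_fintype.1 (isSeparable_iff_mem_convexHull.1 hσ)
  choose a b ha hb hab using hz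
  -- The index `k₀` supplies dummy unit vectors for the columns of weight zero added below.
  obtain ⟨k₀⟩ : Nonempty κ := by
    by_contra hκ
    rw [not_nonempty_iff] at hκ
    simp at hw1
  have hY : σ = productColumns w a b * (productColumns w a b)ᴴ := by
    rw [productColumns_mul_conjTranspose hw, ← hσz]
    ext x y
    simp [Matrix.sum_apply, hab]
  rw [hY] at h
  obtain ⟨K, hZ, hK⟩ := exists_factor_of_posSemidef_fromBlocks h
  obtain ⟨C, hC⟩ := hK.exists_conjTranspose_mul_self
  -- The extra columns `Cᴴ` restore the deficit `ρ - K Kᴴ`; they face zero columns in `Y` and leave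
  -- `X * Yᴴ` unchanged.
  let e := (Fintype.equivFin (κ ⊕ (A × B))).symm
  let X := (fromCols K Cᴴ).submatrix id e
  let q := Sum.elim w (fun _ : A × B => 0) ∘ e
  let a' := Sum.elim a (fun _ : A × B => a k₀) ∘ e
  let b' := Sum.elim b (fun _ : A × B => b k₀) ∘ e
  have hq : ∀ i, 0 ≤ q i := fun i => by
    rcases h : e i with j | j <;> simp [q, h, hw]
  have ha' : ∀ i, ‖a' i‖ = 1 := fun i => by
    rcases h : e i with j | j <;> simp [a', h, ha]
  have hb' : ∀ i, ‖b' i‖ = 1 := fun i => by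
    rcases h : e i with j | j <;> simp [b', h, hb]
  have hq1 : ∑ i, q i = 1 := by
    refine (Equiv.sum_comp e (Sum.elim w fun _ => 0)).trans ?_
    simpa using hw1
  have hYc : productColumns q a' b' = (fromCols (productColumns w a b) 0).submatrix id e := by
    ext x i
    rcases h : e i with j | j <;> simp [productColumns, q, a', b', h]
  have hXX : X * Xᴴ = ρ := by
    rw [conjTranspose_submatrix, submatrix_mul_equiv,
      conjTranspose_fromCols_eq_fromRows_conjTranspose, fromCols_mul_fromRows,
      conjTranspose_conjTranspose, ← hC]
    simp
  have hXY : X * (productColumns q a' b')ᴴ = Z := by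
    rw [hYc, conjTranspose_submatrix, submatrix_mul_equiv,
      conjTranspose_fromCols_eq_fromRows_conjTranspose, fromCols_mul_fromRows, hZ]
    simp
  set Y := productColumns q a' b'
  refine ⟨_, tagColumns X * (tagColumns X)ᴴ, tagColumns Y * (tagColumns Y)ᴴ, ⟨⟨?_, ?_⟩, ?_⟩,
    isClassicalClassical_tagColumns hq hq1 ha' hb', ?_⟩
  · exact posSemidef_self_mul_conjTranspose _
  · rw [← trace_traceAncillas, traceAncillas_tagColumns_mul, hXX, hρ.2]
  · rw [traceAncillas_tagColumns_mul, hXX]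
  · rw [← hXY, ← traceAncillas_tagColumns_mul, trace_traceAncillas]
    refine trace_re_le_fidelity ?_
    convert posSemidef_self_mul_conjTranspose (fromRows (tagColumns X) (tagColumns Y)) using 1
    rw [conjTranspose_fromRows_eq_fromCols_conjTranspose, fromRows_mul_fromCols,
      conjTranspose_mul, conjTranspose_conjTranspose]

end Extension

/-! ### From fidelity to Bures distance -/

section Distance

variable {m n : Type*} [Fintype m] [DecidableEq m] [Fintype n] [DecidableEq n]

theorem buresDist_sq_le {R S : Matrix m m ℂ} {R' S' : Matrix n n ℂ}
    (h : fidelity R S ≤ fidelity R' S') : buresDist R' S' ^ 2 ≤ buresDist R S ^ 2 :=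
  pow_le_pow_left₀ (Real.sqrt_nonneg _) (Real.sqrt_le_sqrt (by linarith)) 2

end Distance

theorem nonempty_setOf_isSeparable {A B : Type*} [Fintype A] [Fintype B]
    {ρ : Matrix (A × B) (A × B) ℂ} (hρ : IsState ρ) :
    {σ : Matrix (A × B) (A × B) ℂ | IsSeparable σ}.Nonempty := by
  classical
  obtain ⟨⟨a, b⟩⟩ : Nonempty (A × B) := by
    by_contra h
    rw [not_nonempty_iff] at h
    simpa [trace] using hρ.2
  exact ⟨_, isSeparable_of_fintype (fun _ : Unit => 1) (fun _ => _) (fun _ => _) (by simp)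
    (by simp) (fun _ => ketbra_isState (u := EuclideanSpace.single a 1) (by simp))
    (fun _ => ketbra_isState (u := EuclideanSpace.single b 1) (by simp))⟩

end BuresDiscord
end

theorem theorem9 {A B : Type*} [Fintype A] [DecidableEq A] [Fintype B] [DecidableEq B]
    (ρ : Matrix (A × B) (A × B) ℂ) (hρ : BuresDiscord.IsState ρ) :
    IsLeast (BuresDiscord.sepDistances ρ) (BuresDiscord.buresEntanglement ρ) ∧
    IsLeast (BuresDiscord.extDistances ρ) (BuresDiscord.minSymmetricBuresDiscord ρ) ∧
    BuresDiscord.minSymmetricBuresDiscord ρ = BuresDiscord.buresEntanglement ρ := by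
  open BuresDiscord in
  obtain ⟨σ, hσ, hmax⟩ := exists_isMaxOn_fidelity hρ isCompact_setOf_isSeparable
    (nonempty_setOf_isSeparable hρ) fun S hS => IsSeparable.isState hS
  have hsep : IsLeast (sepDistances ρ) (buresDist ρ σ ^ 2) := by
    refine ⟨⟨σ, hσ, rfl⟩, ?_⟩
    rintro _ ⟨σ', hσ', rfl⟩
    exact buresDist_sq_le (hmax σ' hσ')
  have hlow : buresDist ρ σ ^ 2 ∈ lowerBounds (extDistances ρ) := by
    rintro _ ⟨m, n, τ, σ', ⟨hτ, rfl⟩, hσ', rfl⟩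
    exact buresDist_sq_le ((fidelity_le_fidelity_traceAncillas hτ.1 hσ'.isState.1).trans
      (hmax _ hσ'.isSeparable_traceAncillas))
  have hext : IsLeast (extDistances ρ) (buresDist ρ σ ^ 2) := by
    refine ⟨?_, hlow⟩
    obtain ⟨Z, hZ, hZF⟩ := exists_trace_re_eq_fidelity hρ.1 (IsSeparable.isState hσ).1
    obtain ⟨N, τ, σ', hτ, hσ', hle⟩ := exists_extension_classicalClassical hρ hσ hZ
    have hmem : buresDist τ σ' ^ 2 ∈ extDistances ρ := ⟨N, N, τ, σ', hτ, hσ', rfl⟩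
    -- The constructed pair is at least as close as `ρ` and `σ`, and the lower bound forces
    -- equality.
    rwa [(hlow hmem).antisymm (buresDist_sq_le (hZF ▸ hle))]
  rw [buresEntanglement, minSymmetricBuresDiscord, hsep.csInf_eq, hext.csInf_eq]
  exact ⟨hsep, hext, rfl⟩
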